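/- Let $[n]=\{1,\dots,n\}$. A binary linear code $C\subseteq\mathbb{F}_2^n$ of length $n$ and dimension $s$ is called a $k$-PIR code if it admits a generator matrix $G\in\mathbb{F}_2^{s\times n}$ (a matrix whose rows form a basis of $C$) such that for every $i\in\{1,\dots,s\}$ there exist $k$ mutually disjoint sets $R^i_1,\dots,R^i_k\subseteq[n]$ with $\sum_{h\in R^i_j}G^h=e_i$ for all $1\le j\le k$, where $G^h$ denotes the $h$th column of $G$ and $e_i$ the $i$th unit vector of $\mathbb{F}_2^s$. Let $P(s,k)$ denote the smallest $n$ such that an $s$-dimensional binary $k$-PIR code of length $n$ exists. **Theorem.** $P(5,8)=18$. That is, there is a binary $5$-dimensional $8$-PIR code of length $18$, and there is none of smaller length. -/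

import Mathlib

/-- A binary linear code of length `n` is a subspace of `𝔽₂ⁿ`; the matrix `G` generates the
code `C` if its rows form a basis of `C`. -/
def IsGeneratorMatrix {s n : ℕ} (G : Matrix (Fin s) (Fin n) (ZMod 2))
    (C : Submodule (ZMod 2) (Fin n → ZMod 2)) : Prop :=
  LinearIndependent (ZMod 2) G.row ∧ Submodule.span (ZMod 2) (Set.range G.row) = C

/-- `R` is a recovery set for the `i`-th information bit with respect to `G`:
the columns of `G` with index in `R` sum to the `i`-th unit vector. -/
def IsRecoverySet {s n : ℕ} (G : Matrix (Fin s) (Fin n) (ZMod 2)) (i : Fin s)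
    (R : Finset (Fin n)) : Prop :=
  ∑ h ∈ R, G.col h = Pi.single i 1

/-- The binary linear code `C` of length `n` is an `s`-dimensional `k`-PIR code: it has
dimension `s` and admits a generator matrix for which every information bit has `k` mutually
disjoint recovery sets. -/
def IsPIRCode {n : ℕ} (s k : ℕ) (C : Submodule (ZMod 2) (Fin n → ZMod 2)) : Prop :=
  Module.finrank (ZMod 2) C = s ∧
    ∃ G : Matrix (Fin s) (Fin n) (ZMod 2), IsGeneratorMatrix G C ∧
      ∀ i : Fin s, ∃ R : Fin k → Finset (Fin n),
        Pairwise (fun j j' => Disjoint (R j) (R j')) ∧ ∀ j, IsRecoverySet G i (R j)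

/-- The lengths `n` for which an `s`-dimensional `k`-PIR code of length `n` exists. -/
def pirLengths (s k : ℕ) : Set ℕ :=
  {n | ∃ C : Submodule (ZMod 2) (Fin n → ZMod 2), IsPIRCode s k C}

/-- `P(s, k)`: the smallest length of an `s`-dimensional `k`-PIR code.
(`sInf ∅ = 0` in `ℕ`, so a positive value is attained.) -/
noncomputable def pirLength (s k : ℕ) : ℕ := sInf (pirLengths s k)

/-!
Let `x h ∈ 𝔽₂⁵` be the columns of a generator matrix; the codewords are `φ ∘ x` for linear
functionals `φ`. If `φ eᵢ ≠ 0`, every recovery set of `eᵢ` contains a column on which `φ` does not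
vanish, so an `8`-PIR code has minimum distance at least `8`.

Suppose the length is `17`. Modulo `eᵢ`, the columns form a `[17, 4, 8]` code with eight disjoint
nonempty zero-sum sets of columns. Such a set has at least three elements unless it contains a zero
column or is a pair of equal columns, so with `z` zero columns there are at least `7 - 2z` disjoint
pairs of equal nonzero columns. In either case some codeword has weight at least `14`:

* If `z > 0`, assume that all nonzero weights lie in `[8, 13]`. The first two power moments of the
  weights bound the sum of `(w - 8) * (13 - w)` by `16 * (1 - z)`, so `z = 1` and all nonzero
  weights are `8` or `13`. But the excesses `w - 8` sum to `8`, which is not a multiple of `5`.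
* If `z = 0`, the Plotkin bound shows that the vectors of seven of the pairs are distinct and form a
  sum-free set. The third moment of its character sums vanishes, which forces a sum-free set of this
  size into the complement of a hyperplane, and the codeword of that hyperplane is nonzero on all
  seven pairs.

So for every `i` there is `φᵢ` with `φᵢ eᵢ = 0` and a codeword of weight at least `14`. Two such
codewords are at distance at most `3 + 3 < 8`, so all `φᵢ` coincide and vanish on the whole basis,
a contradiction.
-/

open Finset Module

namespace PIR

/-- The nontrivial character of `𝔽₂`, with values `±1` in `ℤ`. -/
def signChar : AddChar (ZMod 2) ℤ := AddChar.zmodChar 2 (ζ := -1) (by norm_num)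

theorem signChar_eq (a : ZMod 2) : signChar a = 1 - 2 * if a ≠ 0 then 1 else 0 := by
  revert a; decide

variable {ι V : Type*} [AddCommGroup V] [Module (ZMod 2) V]

theorem card_dual [Finite V] [Fintype (Dual (ZMod 2) V)] :
    Fintype.card (Dual (ZMod 2) V) = Nat.card V := by
  rw [← Nat.card_eq_fintype_card, natCard_eq_pow_finrank (K := ZMod 2), Subspace.dual_finrank_eq,
    ← natCard_eq_pow_finrank]

instance finite_dual [Finite V] : Finite (Dual (ZMod 2) V) := DFunLike.finite _

theorem sum_dual_signChar [Finite V] [Fintype (Dual (ZMod 2) V)] [DecidableEq V] (v : V) :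
    ∑ φ : Dual (ZMod 2) V, signChar (φ v) = if v = 0 then (Nat.card V : ℤ) else 0 := by
  classical
  let ψ : AddChar (Dual (ZMod 2) V) ℤ :=
    signChar.compAddMonoidHom (Dual.eval (ZMod 2) V v).toAddMonoidHom
  have hψ : ψ = 0 ↔ v = 0 := by
    rw [← forall_dual_apply_eq_zero_iff (ZMod 2) v, DFunLike.ext_iff]
    refine forall_congr' fun φ => ?_
    change signChar (φ v) = 1 ↔ φ v = 0
    generalize φ v = a
    revert a; decide
  calc ∑ φ : Dual (ZMod 2) V, signChar (φ v) = ∑ φ, ψ φ := rfl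
    _ = if v = 0 then (Nat.card V : ℤ) else 0 := by
      simp only [AddChar.sum_eq_ite, hψ, card_dual]

theorem hammingNorm_zero_comp [Fintype ι] (x : ι → V) :
    hammingNorm ((0 : Dual (ZMod 2) V) ∘ x) = 0 :=
  hammingNorm_zero

section CharSum

variable [Fintype ι]

/-- The character sum of the codeword `φ ∘ x`. -/
def charSum (x : ι → V) (φ : Dual (ZMod 2) V) : ℤ :=
  ∑ h, signChar (φ (x h))

theorem charSum_eq (x : ι → V) (φ : Dual (ZMod 2) V) :
    charSum x φ = Fintype.card ι - 2 * hammingNorm (φ ∘ x) := by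
  simp only [charSum, signChar_eq, sum_sub_distrib, ← mul_sum, sum_boole]
  simp [hammingNorm]

variable [Finite V] [Fintype (Dual (ZMod 2) V)] [DecidableEq V]

theorem sum_charSum_pow (x : ι → V) (r : ℕ) :
    ∑ φ, charSum x φ ^ r = Nat.card V * #{t : Fin r → ι | ∑ i, x (t i) = 0} := by
  have hprod (φ : Dual (ZMod 2) V) (t : Fin r → ι) :
      ∏ i, signChar (φ (x (t i))) = signChar (φ (∑ i, x (t i))) := by
    rw [map_sum]
    exact (map_prod signChar.toMonoidHom (fun i => Multiplicative.ofAdd (φ (x (t i)))) univ).symm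
  simp only [charSum, Fintype.sum_pow, hprod]
  rw [sum_comm]
  simp only [sum_dual_signChar, ← sum_filter, sum_const, nsmul_eq_mul, mul_comm]

theorem sum_charSum (x : ι → V) : ∑ φ, charSum x φ = Nat.card V * #{h | x h = 0} := by
  have h := sum_charSum_pow x 1
  simp only [pow_one, univ_unique, sum_singleton] at h
  rw [h, card_equiv (t := {h | x h = 0}) (Equiv.funUnique (Fin 1) ι) (by simp)]

theorem sum_charSum_sq (x : ι → V) :
    ∑ φ, charSum x φ ^ 2 = Nat.card V * #{p : ι × ι | x p.1 = x p.2} := by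
  rw [sum_charSum_pow, card_equiv (t := {p : ι × ι | x p.1 = x p.2}) (finTwoArrowEquiv ι)]
  simp [add_eq_zero_iff_eq_neg, ZModModule.neg_eq_self]

theorem two_mul_sum_hammingNorm (x : ι → V) :
    2 * ∑ φ : Dual (ZMod 2) V, (hammingNorm (φ ∘ x) : ℤ) =
      Nat.card V * (Fintype.card ι - #{h | x h = 0}) := by
  have h := sum_charSum x
  simp only [charSum_eq, sum_sub_distrib, sum_const, card_univ, card_dual, nsmul_eq_mul,
    ← mul_sum] at h
  linarith

theorem four_mul_sum_hammingNorm_sq (x : ι → V) :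
    4 * ∑ φ : Dual (ZMod 2) V, (hammingNorm (φ ∘ x) : ℤ) ^ 2 =
      Nat.card V * (Fintype.card ι ^ 2 - 2 * Fintype.card ι * #{h | x h = 0} +
        #{p : ι × ι | x p.1 = x p.2}) := by
  have h (φ : Dual (ZMod 2) V) : 4 * (hammingNorm (φ ∘ x) : ℤ) ^ 2 =
      Fintype.card ι ^ 2 - 2 * Fintype.card ι * charSum x φ + charSum x φ ^ 2 := by
    rw [charSum_eq]; ring
  rw [mul_sum, sum_congr rfl fun φ _ => h φ]
  simp only [sum_add_distrib, sum_sub_distrib, sum_const, card_univ, card_dual, nsmul_eq_mul,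
    ← mul_sum, sum_charSum, sum_charSum_sq]
  ring

end CharSum

theorem exists_dual_forall_ne_zero_of_sumFree [Finite V] {A : Finset V}
    (hA : ∀ a ∈ A, ∀ b ∈ A, a + b ∉ A)
    (hcard : ((#A : ℤ) - 2) * Nat.card V < 2 * #A * (#A - 1)) :
    ∃ φ : Dual (ZMod 2) V, ∀ a ∈ A, φ a ≠ 0 := by
  classical
  have := Fintype.ofFinite (Dual (ZMod 2) V)
  by_contra! hcon
  let x : A → V := (↑)
  have hF (φ : Dual (ZMod 2) V) : 0 ≤ charSum x φ + (#A - 2) := by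
    obtain ⟨a, ha, hφa⟩ := hcon φ
    have hlt : hammingNorm (φ ∘ x) < #A :=
      (card_lt_univ_of_notMem (x := ⟨a, ha⟩) (by simp [x, hφa])).trans_eq (Fintype.card_coe A)
    rw [charSum_eq, Fintype.card_coe]
    omega
  have h0 : charSum x 0 = #A := by
    simp [charSum]
  have h2 : ∑ φ, charSum x φ ^ 2 = Nat.card V * #A := by
    have hdiag : ({p : A × A | x p.1 = x p.2} : Finset (A × A)) = univ.diag := by
      ext p
      simpa only [mem_filter, mem_univ, true_and, mem_diag] using Subtype.ext_iff.symm
    rw [sum_charSum_sq, hdiag, diag_card, card_univ, Fintype.card_coe]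
  have h3 : ∑ φ, charSum x φ ^ 3 = 0 := by
    rw [sum_charSum_pow, filter_false_of_mem, card_empty, Nat.cast_zero, mul_zero]
    intro t _ ht
    rw [Fin.sum_univ_three, add_eq_zero_iff_eq_neg, ZModModule.neg_eq_self] at ht
    exact hA _ (t 0).2 _ (t 1).2 (ht ▸ (t 2).2)
  have hle : (#A : ℤ) ^ 2 * (#A + (#A - 2)) ≤ #A * ((#A - 2) * Nat.card V) := calc
    (#A : ℤ) ^ 2 * (#A + (#A - 2)) = charSum x 0 ^ 2 * (charSum x 0 + (#A - 2)) := by rw [h0]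
    _ ≤ ∑ φ, charSum x φ ^ 2 * (charSum x φ + (#A - 2)) :=
      single_le_sum (f := fun φ => charSum x φ ^ 2 * (charSum x φ + (#A - 2)))
        (fun φ _ => mul_nonneg (sq_nonneg _) (hF φ)) (mem_univ 0)
    _ = #A * ((#A - 2) * Nat.card V) := by
      simp only [mul_add, ← pow_succ, sum_add_distrib, ← sum_mul, h2, h3]
      ring
  obtain ⟨a, ha, -⟩ := hcon 0
  have hpos : (0 : ℤ) < #A := by exact_mod_cast card_pos.2 ⟨a, ha⟩
  nlinarith

section MinDist

variable [Fintype ι] {U : Type*} [AddCommGroup U] [Module (ZMod 2) U]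

/-- The codewords `φ ∘ x` with `φ ≠ 0` have weight at least `d`: the code generated by the matrix
with columns `x h` has minimum distance at least `d`. Distinct `φ` then give distinct codewords as
soon as `0 < d`. -/
def HasMinDist (x : ι → V) (d : ℕ) : Prop :=
  ∀ φ : Dual (ZMod 2) V, φ ≠ 0 → d ≤ hammingNorm (φ ∘ x)

namespace HasMinDist

variable {x : ι → V} {d : ℕ}

theorem comp_surjective (hx : HasMinDist x d) {f : V →ₗ[ZMod 2] U} (hf : Function.Surjective f) :
    HasMinDist (f ∘ x) d := fun φ hφ =>
  hx (φ ∘ₗ f) fun h => hφ ((LinearMap.cancel_right hf).1 (h.trans (LinearMap.zero_comp f).symm))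

theorem eq_of_lt_hammingNorm_add (hx : HasMinDist x d) {φ ψ : Dual (ZMod 2) V}
    (h : 2 * Fintype.card ι < hammingNorm (φ ∘ x) + hammingNorm (ψ ∘ x) + d) : φ = ψ := by
  have hone (c : ι → ZMod 2) : hammingDist c 1 + hammingNorm c = Fintype.card ι := by
    have hiff (a : ZMod 2) : a ≠ 1 ↔ ¬ a ≠ 0 := by revert a; decide
    rw [add_comm, ← card_univ]
    simp only [hammingDist, hammingNorm, Pi.one_apply, hiff]
    exact card_filter_add_card_filter_not _
  by_contra hne
  have hdist : d ≤ hammingDist (φ ∘ x) (ψ ∘ x) := by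
    rw [hammingDist_eq_hammingNorm, neg_add_eq_sub]
    exact hx (ψ - φ) (sub_ne_zero.2 (Ne.symm hne))
  have := hammingDist_triangle_right (φ ∘ x) (ψ ∘ x) 1
  have := hone (φ ∘ x)
  have := hone (ψ ∘ x)
  omega

variable [Finite V]

/-- The Plotkin bound, obtained by averaging the weights of the nonzero codewords. -/
theorem card_mul_card_zero_add_le [DecidableEq V] (hx : HasMinDist x d) :
    Nat.card V * (#{h | x h = 0} + 2 * d) ≤ Nat.card V * Fintype.card ι + 2 * d := by
  classical
  have := Fintype.ofFinite (Dual (ZMod 2) V)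
  have hle : ∑ φ : Dual (ZMod 2) V, ((d : ℤ) - if φ = 0 then (d : ℤ) else 0) ≤
      ∑ φ : Dual (ZMod 2) V, (hammingNorm (φ ∘ x) : ℤ) := by
    refine sum_le_sum fun φ _ => ?_
    split_ifs with hφ
    · simp
    · simpa using hx φ hφ
  simp only [sum_sub_distrib, sum_const, card_univ, card_dual, nsmul_eq_mul, sum_ite_eq',
    mem_univ, if_true] at hle
  have := two_mul_sum_hammingNorm x
  zify
  linarith

theorem card_mul_card_mem_add_le (hx : HasMinDist x d) (W : Submodule (ZMod 2) V)
    [DecidablePred (· ∈ W)] :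
    Nat.card V * (#{h | x h ∈ W} + 2 * d) ≤
      Nat.card V * Fintype.card ι + Nat.card W * (2 * d) := by
  classical
  have : Finite (V ⧸ W) := .of_surjective _ W.mkQ_surjective
  have h := (hx.comp_surjective W.mkQ_surjective).card_mul_card_zero_add_le
  simp only [Function.comp_apply, W.mkQ_apply, Submodule.Quotient.mk_eq_zero] at h
  rw [W.card_eq_card_quotient_mul_card, mul_assoc, mul_assoc]
  nlinarith

end HasMinDist

end MinDist

section Twins

variable {κ α : Type*}

/-- `T` is a pair of indices at which the family `x` repeats the vector `v`. -/
def IsTwin (x : ι → α) (v : α) (T : Finset ι) : Prop :=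
  #T = 2 ∧ ∀ h ∈ T, x h = v

section Count

variable [Fintype ι] {x : ι → α} {R : κ → Finset ι} {P : Finset κ} {v : κ → α}

theorem two_mul_card_le_of_isTwin (hdisj : Pairwise fun j j' => Disjoint (R j) (R j'))
    (hP : ∀ j ∈ P, IsTwin x (v j) (R j)) {p : α → Prop} [DecidablePred p]
    (hp : ∀ j ∈ P, p (v j)) : 2 * #P ≤ #{h | p (x h)} := by
  classical
  calc 2 * #P = ∑ j ∈ P, #(R j) := by
        rw [sum_congr rfl fun j hj => (hP j hj).1, sum_const, smul_eq_mul, mul_comm]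
    _ = #(P.biUnion R) := (card_biUnion fun j _ j' _ h => hdisj h).symm
    _ ≤ #{h | p (x h)} := card_le_card fun h hh => by
        obtain ⟨j, hj, hhj⟩ := mem_biUnion.1 hh
        simpa [(hP j hj).2 h hhj] using hp j hj

theorem card_add_two_mul_card_le_of_isTwin [DecidableEq α]
    (hdisj : Pairwise fun j j' => Disjoint (R j) (R j'))
    (hP : ∀ j ∈ P, IsTwin x (v j) (R j)) :
    Fintype.card ι + 2 * #P ≤ #{p : ι × ι | x p.1 = x p.2} := by
  classical
  have hP2 : #(P.biUnion fun j => (R j).offDiag) = 2 * #P := by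
    rw [card_biUnion, sum_congr rfl fun j hj => by rw [offDiag_card, (hP j hj).1]]
    · simp [mul_comm]
    · intro j _ j' _ h
      refine disjoint_left.2 fun p hp hp' => ?_
      exact disjoint_left.1 (hdisj h) (mem_offDiag.1 hp).1 (mem_offDiag.1 hp').1
  rw [← hP2, ← card_univ, ← diag_card, ← card_union_of_disjoint]
  · refine card_le_card fun p hp => ?_
    simp only [mem_union, mem_diag, mem_univ, true_and, mem_biUnion, mem_offDiag] at hp
    obtain h | ⟨j, hj, h1, h2, -⟩ := hp
    · simp [h]
    · simp [(hP j hj).2 _ h1, (hP j hj).2 _ h2]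
  · rw [disjoint_biUnion_right]
    exact fun j _ => disjoint_left.2 fun p hp hp' =>
      (mem_offDiag.1 hp').2.2 (mem_diag.1 hp).2

end Count

theorem exists_isTwin_of_card_lt_three [DecidableEq V] {x : ι → V} {T : Finset ι}
    (hT : T.Nonempty) (hsum : ∑ h ∈ T, x h = 0) (hlt : #T + 2 * #{h ∈ T | x h = 0} < 3) :
    ∃ v ≠ 0, IsTwin x v T := by
  classical
  have hpos := hT.card_pos
  have hne : ∀ h ∈ T, x h ≠ 0 := filter_eq_empty_iff.1 (card_eq_zero.1 (by omega))
  obtain hT1 | hT2 : #T = 1 ∨ #T = 2 := by omega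
  · obtain ⟨h, rfl⟩ := card_eq_one.1 hT1
    exact absurd (by simpa using hsum) (hne h (mem_singleton_self h))
  · obtain ⟨h, k, hhk, rfl⟩ := card_eq_two.1 hT2
    rw [sum_pair hhk, add_eq_zero_iff_eq_neg, ZModModule.neg_eq_self] at hsum
    exact ⟨x k, hne k (by simp), hT2, by simp [hsum]⟩

theorem exists_isTwin_family [Fintype ι] [Fintype κ] [DecidableEq V] {x : ι → V}
    {R : κ → Finset ι} (hdisj : Pairwise fun j j' => Disjoint (R j) (R j'))
    (hne : ∀ j, (R j).Nonempty) (hsum : ∀ j, ∑ h ∈ R j, x h = 0) :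
    ∃ (P : Finset κ) (v : κ → V), (∀ j ∈ P, v j ≠ 0 ∧ IsTwin x (v j) (R j)) ∧
      3 * Fintype.card κ ≤ Fintype.card ι + #P + 2 * #{h | x h = 0} := by
  classical
  let P : Finset κ := {j | #(R j) + 2 * #{h ∈ R j | x h = 0} < 3}
  have htwin (j : κ) : ∃ v, j ∈ P → v ≠ 0 ∧ IsTwin x v (R j) := by
    by_cases hj : j ∈ P
    · obtain ⟨v, hv⟩ := exists_isTwin_of_card_lt_three (hne j) (hsum j) (mem_filter.1 hj).2
      exact ⟨v, fun _ => hv⟩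
    · exact ⟨0, fun h => absurd h hj⟩
  choose v hv using htwin
  refine ⟨P, v, hv, ?_⟩
  have hcard : ∑ j, #(R j) ≤ Fintype.card ι := by
    rw [← card_biUnion fun j _ j' _ h => hdisj h]
    exact card_le_univ _
  have hzero : ∑ j, #{h ∈ R j | x h = 0} ≤ #{h | x h = 0} := by
    rw [← card_biUnion fun j _ j' _ h => disjoint_filter_filter (hdisj h)]
    exact card_le_card fun h => by simp
  calc 3 * Fintype.card κ = ∑ _j : κ, 3 := by simp [mul_comm]
    _ ≤ ∑ j, (#(R j) + (if j ∈ P then 1 else 0) + 2 * #{h ∈ R j | x h = 0}) := by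
      refine sum_le_sum fun j _ => ?_
      have := (hne j).card_pos
      by_cases hj : j ∈ P
      · have := (hv j hj).2.1
        simp only [hj, if_true]
        omega
      · have : ¬ _ := fun h => hj (mem_filter.2 ⟨mem_univ j, h⟩)
        simp only [hj, if_false]
        omega
    _ = ∑ j, #(R j) + #P + 2 * ∑ j, #{h ∈ R j | x h = 0} := by
      rw [sum_add_distrib, sum_add_distrib, ← mul_sum, ← card_filter, filter_univ_mem]
    _ ≤ Fintype.card ι + #P + 2 * #{h | x h = 0} := by gcongr

end Twins

section Seventeen

variable [Fintype ι] [Finite V] {x : ι → V}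

section WeightSums

variable [Fintype (Dual (ZMod 2) V)] [DecidableEq (Dual (ZMod 2) V)] [DecidableEq V]

theorem sum_erase_zero_hammingNorm_sub (hι : Fintype.card ι = 17) (hV : Nat.card V = 16)
    (x : ι → V) :
    ∑ φ ∈ univ.erase (0 : Dual (ZMod 2) V), ((hammingNorm (φ ∘ x) : ℤ) - 8) =
      16 - 8 * #{h | x h = 0} := by
  have h := two_mul_sum_hammingNorm x
  rw [hV, hι] at h
  rw [sum_erase_eq_sub (mem_univ 0), sum_sub_distrib, sum_const, nsmul_eq_mul, card_univ,
    card_dual, hV, hammingNorm_zero_comp]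
  push_cast at h ⊢
  linarith

theorem sum_erase_zero_hammingNorm_quadratic (hι : Fintype.card ι = 17) (hV : Nat.card V = 16)
    (x : ι → V) :
    ∑ φ ∈ univ.erase (0 : Dual (ZMod 2) V),
        ((hammingNorm (φ ∘ x) : ℤ) - 8) * (13 - hammingNorm (φ ∘ x)) =
      140 - 32 * #{h | x h = 0} - 4 * #{p : ι × ι | x p.1 = x p.2} := by
  have h₁ := two_mul_sum_hammingNorm x
  have h₂ := four_mul_sum_hammingNorm_sq x
  have hexpand (w : ℤ) : (w - 8) * (13 - w) = 21 * w - w ^ 2 - 104 := by ring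
  rw [hV, hι] at h₁ h₂
  simp only [hexpand]
  rw [sum_erase_eq_sub (mem_univ 0), sum_sub_distrib, sum_sub_distrib, ← mul_sum, sum_const,
    nsmul_eq_mul, card_univ, card_dual, hV, hammingNorm_zero_comp]
  push_cast at h₁ h₂ ⊢
  linarith

end WeightSums

theorem exists_fourteen_le_hammingNorm_of_zero [DecidableEq V] (hι : Fintype.card ι = 17)
    (hV : Nat.card V = 16) (hx : HasMinDist x 8) (hzero : 0 < #{h | x h = 0})
    (hpairs : 31 ≤ #{p : ι × ι | x p.1 = x p.2} + 4 * #{h | x h = 0}) :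
    ∃ φ : Dual (ZMod 2) V, 14 ≤ hammingNorm (φ ∘ x) := by
  classical
  have := Fintype.ofFinite (Dual (ZMod 2) V)
  by_contra! hlt
  have hnonneg : ∀ φ ∈ univ.erase (0 : Dual (ZMod 2) V),
      0 ≤ ((hammingNorm (φ ∘ x) : ℤ) - 8) * (13 - hammingNorm (φ ∘ x)) := fun φ hφ => by
    have h8 := hx φ (ne_of_mem_erase hφ)
    have h13 := hlt φ
    exact mul_nonneg (by omega) (by omega)
  have hquad := sum_erase_zero_hammingNorm_quadratic hι hV x
  have hquad_nonneg := sum_nonneg hnonneg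
  have hquad_zero : ∑ φ ∈ univ.erase (0 : Dual (ZMod 2) V),
      ((hammingNorm (φ ∘ x) : ℤ) - 8) * (13 - hammingNorm (φ ∘ x)) = 0 := by omega
  have hz : #{h | x h = 0} = 1 := by omega
  have hdvd : (5 : ℤ) ∣ ∑ φ ∈ univ.erase (0 : Dual (ZMod 2) V),
      ((hammingNorm (φ ∘ x) : ℤ) - 8) := dvd_sum fun φ hφ => by
    have h := (sum_eq_zero_iff_of_nonneg hnonneg).1 hquad_zero φ hφ
    rcases mul_eq_zero.1 h with h | h <;> omega
  rw [sum_erase_zero_hammingNorm_sub hι hV, hz] at hdvd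
  norm_num at hdvd

theorem two_mul_card_le_of_isTwin_of_mem_span (hι : Fintype.card ι = 17) (hV : Nat.card V = 16)
    (hx : HasMinDist x 8) {κ : Type*} {R : κ → Finset ι}
    (hdisj : Pairwise fun j j' => Disjoint (R j) (R j')) {P : Finset κ} {v : κ → V}
    (hP : ∀ j ∈ P, IsTwin x (v j) (R j)) (T : Finset V)
    (hT : ∀ j ∈ P, v j ∈ Submodule.span (ZMod 2) (T : Set V)) : 2 * #P ≤ 1 + 2 ^ #T := by
  classical
  have hcard : Nat.card (Submodule.span (ZMod 2) (T : Set V)) ≤ 2 ^ #T := by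
    rw [natCard_eq_pow_finrank (K := ZMod 2), Nat.card_zmod]
    exact Nat.pow_le_pow_right two_pos (finrank_span_finset_le_card T)
  have htwin := two_mul_card_le_of_isTwin hdisj hP hT
  have hplotkin := hx.card_mul_card_mem_add_le (Submodule.span (ZMod 2) (T : Set V))
  rw [hV, hι] at hplotkin
  omega

theorem injOn_of_isTwin (hι : Fintype.card ι = 17) (hV : Nat.card V = 16) (hx : HasMinDist x 8)
    {κ : Type*} {R : κ → Finset ι} (hdisj : Pairwise fun j j' => Disjoint (R j) (R j'))
    {P : Finset κ} {v : κ → V} (hP : ∀ j ∈ P, IsTwin x (v j) (R j)) : Set.InjOn v P := by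
  classical
  intro j hj k hk hjk
  by_contra hne
  have h := two_mul_card_le_of_isTwin_of_mem_span hι hV hx hdisj (P := {j, k}) (v := v)
    (by grind) {v j} (by simp [← hjk])
  rw [card_pair hne, card_singleton] at h
  omega

theorem add_notMem_image_of_isTwin [DecidableEq V] (hι : Fintype.card ι = 17)
    (hV : Nat.card V = 16) (hx : HasMinDist x 8) {κ : Type*} {R : κ → Finset ι}
    (hdisj : Pairwise fun j j' => Disjoint (R j) (R j')) {P : Finset κ} {v : κ → V}
    (hP : ∀ j ∈ P, v j ≠ 0 ∧ IsTwin x (v j) (R j)) :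
    ∀ a ∈ P.image v, ∀ b ∈ P.image v, a + b ∉ P.image v := by
  classical
  simp only [mem_image]
  rintro _ ⟨j, hj, rfl⟩ _ ⟨k, hk, rfl⟩ ⟨l, hl, hjkl⟩
  have hjk : j ≠ k := fun h => (hP l hl).1 (by rw [hjkl, h, ZModModule.add_self])
  have hjl : j ≠ l := fun h => (hP k hk).1 (by simpa [h] using hjkl)
  have hkl : k ≠ l := fun h => (hP j hj).1 (by simpa [h] using hjkl)
  have hmem {a : V} (ha : a ∈ ({v j, v k} : Finset V)) :
      a ∈ Submodule.span (ZMod 2) (({v j, v k} : Finset V) : Set V) :=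
    Submodule.subset_span (mem_coe.2 ha)
  have h := two_mul_card_le_of_isTwin_of_mem_span hι hV hx hdisj (P := {j, k, l}) (v := v)
    (by grind) {v j, v k} (by
      simp only [mem_insert, mem_singleton, forall_eq_or_imp, forall_eq, hjkl]
      exact ⟨hmem (by simp), hmem (by simp), add_mem (hmem (by simp)) (hmem (by simp))⟩)
  rw [card_eq_three.2 ⟨j, k, l, hjk, hjl, hkl, rfl⟩] at h
  have := Nat.pow_le_pow_right two_pos (card_le_two (a := v j) (b := v k))
  omega

theorem exists_fourteen_le_hammingNorm_of_isTwin (hι : Fintype.card ι = 17)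
    (hV : Nat.card V = 16) (hx : HasMinDist x 8) {κ : Type*} {R : κ → Finset ι}
    (hdisj : Pairwise fun j j' => Disjoint (R j) (R j')) {P : Finset κ} {v : κ → V}
    (hP : ∀ j ∈ P, v j ≠ 0 ∧ IsTwin x (v j) (R j)) (hcard : 7 ≤ #P) :
    ∃ φ : Dual (ZMod 2) V, 14 ≤ hammingNorm (φ ∘ x) := by
  classical
  have htwin : ∀ j ∈ P, IsTwin x (v j) (R j) := fun j hj => (hP j hj).2
  have hlarge : (#(P.image v) - 2 : ℤ) * Nat.card V < 2 * #(P.image v) * (#(P.image v) - 1) := by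
    rw [card_image_of_injOn (injOn_of_isTwin hι hV hx hdisj htwin), hV]
    zify at hcard
    push_cast
    nlinarith
  obtain ⟨φ, hφ⟩ := exists_dual_forall_ne_zero_of_sumFree
    (add_notMem_image_of_isTwin hι hV hx hdisj hP) hlarge
  have h := two_mul_card_le_of_isTwin hdisj htwin (p := (φ · ≠ 0))
    fun j hj => hφ _ (mem_image_of_mem v hj)
  exact ⟨φ, le_trans (by omega) h⟩

theorem exists_fourteen_le_hammingNorm (hι : Fintype.card ι = 17) (hV : Nat.card V = 16)
    (hx : HasMinDist x 8) {R : Fin 8 → Finset ι}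
    (hdisj : Pairwise fun j j' => Disjoint (R j) (R j'))
    (hne : ∀ j, (R j).Nonempty) (hsum : ∀ j, ∑ h ∈ R j, x h = 0) :
    ∃ φ : Dual (ZMod 2) V, 14 ≤ hammingNorm (φ ∘ x) := by
  classical
  obtain ⟨P, v, hP, hcard⟩ := exists_isTwin_family hdisj hne hsum
  have hpairs := card_add_two_mul_card_le_of_isTwin hdisj fun j hj => (hP j hj).2
  rw [hι, Fintype.card_fin] at hcard
  rcases Nat.eq_zero_or_pos #{h | x h = 0} with hzero | hzero
  · exact exists_fourteen_le_hammingNorm_of_isTwin hι hV hx hdisj hP (by omega)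
  · exact exists_fourteen_le_hammingNorm_of_zero hι hV hx hzero (by omega)

end Seventeen

section Recovery

section

variable {M : Type*} [AddCommMonoid M] {x : ι → M} {k : ℕ} {v : M}

/-- The vector `v` has `k` mutually disjoint recovery sets in the family `x` of columns. -/
def IsRecoverable (x : ι → M) (k : ℕ) (v : M) : Prop :=
  ∃ R : Fin k → Finset ι, (Pairwise fun j j' => Disjoint (R j) (R j')) ∧
    ∀ j, ∑ h ∈ R j, x h = v

theorem IsRecoverable.extend {κ : Type*} (hv : IsRecoverable x k v) (f : ι ↪ κ) :
    IsRecoverable (Function.extend f x 0) k v := by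
  obtain ⟨R, hdisj, hR⟩ := hv
  refine ⟨fun j => (R j).map f, fun j j' hne => (disjoint_map f).2 (hdisj hne), fun j => ?_⟩
  simpa only [sum_map, f.injective.extend_apply] using hR j

end

variable [Fintype ι] {x : ι → V} {k : ℕ}

theorem IsRecoverable.le_hammingNorm {v : V} (hv : IsRecoverable x k v)
    {φ : Dual (ZMod 2) V} (hφ : φ v ≠ 0) : k ≤ hammingNorm (φ ∘ x) := by
  obtain ⟨R, hdisj, hR⟩ := hv
  have hex (j : Fin k) : ∃ h ∈ R j, φ (x h) ≠ 0 := by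
    by_contra! h
    rw [← hR j, map_sum, sum_eq_zero h] at hφ
    exact hφ rfl
  choose r hr hrφ using hex
  have hinj : Function.Injective r := fun j j' h => by
    by_contra hne
    exact disjoint_left.1 (hdisj hne) (hr j) (h ▸ hr j')
  calc k = #(univ : Finset (Fin k)) := by simp
    _ ≤ hammingNorm (φ ∘ x) :=
      card_le_card_of_injOn r (fun j _ => by simpa using hrφ j) hinj.injOn

theorem hasMinDist_of_span_eq_top {κ : Type*} {v : κ → V}
    (hspan : Submodule.span (ZMod 2) (Set.range v) = ⊤) (hv : ∀ i, IsRecoverable x k (v i)) :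
    HasMinDist x k := by
  intro φ hφ
  obtain ⟨i, hi⟩ : ∃ i, φ (v i) ≠ 0 := by
    by_contra! h
    exact hφ (LinearMap.ext_on_range hspan h)
  exact (hv i).le_hammingNorm hi

theorem exists_dual_eq_zero_and_fourteen_le_hammingNorm [Finite V] (hι : Fintype.card ι = 17)
    (hV : Nat.card V = 32) (hx : HasMinDist x 8) {e : V} (he : e ≠ 0)
    (hrec : IsRecoverable x 8 e) :
    ∃ φ : Dual (ZMod 2) V, φ e = 0 ∧ 14 ≤ hammingNorm (φ ∘ x) := by
  let W := Submodule.span (ZMod 2) {e}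
  have hWe : W.mkQ e = 0 :=
    (Submodule.Quotient.mk_eq_zero W).2 (Submodule.mem_span_singleton_self e)
  have hcard : Nat.card (V ⧸ W) = 16 := by
    have hW : Nat.card W = 2 := by
      rw [natCard_eq_pow_finrank (K := ZMod 2), finrank_span_singleton he, Nat.card_zmod, pow_one]
    have h := W.card_eq_card_quotient_mul_card
    rw [hV, hW] at h
    omega
  have : Finite (V ⧸ W) := .of_surjective _ W.mkQ_surjective
  obtain ⟨R, hdisj, hR⟩ := hrec
  have hne (j : Fin 8) : (R j).Nonempty :=
    nonempty_of_sum_ne_zero (f := x) (by rwa [hR j])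
  have hsum (j : Fin 8) : ∑ h ∈ R j, (W.mkQ ∘ x) h = 0 := by
    simp only [Function.comp_apply, ← map_sum, hR j, hWe]
  obtain ⟨φ, hφ⟩ := exists_fourteen_le_hammingNorm hι hcard
    (hx.comp_surjective W.mkQ_surjective) hdisj hne hsum
  exact ⟨φ ∘ₗ W.mkQ, by rw [LinearMap.comp_apply, hWe, map_zero], hφ⟩

end Recovery

theorem not_forall_isRecoverable_single [Fintype ι] (hι : Fintype.card ι = 17)
    (x : ι → Fin 5 → ZMod 2) : ¬ ∀ i, IsRecoverable x 8 (Pi.single i 1 : Fin 5 → ZMod 2) := by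
  intro hrec
  let b := Pi.basisFun (ZMod 2) (Fin 5)
  have hb (i : Fin 5) : IsRecoverable x 8 (b i) := by
    simpa only [b, Pi.basisFun_apply] using hrec i
  have hx : HasMinDist x 8 := hasMinDist_of_span_eq_top b.span_eq hb
  choose φ hφ hweight using fun i =>
    exists_dual_eq_zero_and_fourteen_le_hammingNorm hι (by simp) hx (b.ne_zero i) (hb i)
  have heq (i j : Fin 5) : φ i = φ j := hx.eq_of_lt_hammingNorm_add (by
    have := hweight i
    have := hweight j
    omega)
  have hzero : φ 0 = 0 := b.ext fun i => by rw [heq 0 i, hφ i, LinearMap.zero_apply]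
  have := hweight 0
  rw [hzero, hammingNorm_zero_comp] at this
  omega

theorem mem_pirLengths_iff {s k n : ℕ} (hk : 0 < k) :
    n ∈ pirLengths s k ↔
      ∃ x : Fin n → Fin s → ZMod 2, ∀ i, IsRecoverable x k (Pi.single i 1 : Fin s → ZMod 2) := by
  constructor
  · rintro ⟨C, -, G, -, hG⟩
    exact ⟨G.col, hG⟩
  · rintro ⟨x, hx⟩
    let G : Matrix (Fin s) (Fin n) (ZMod 2) := (Matrix.of x).transpose
    have hdist : HasMinDist x k := hasMinDist_of_span_eq_top
      (Pi.basisFun (ZMod 2) (Fin s)).span_eq (by simpa only [Pi.basisFun_apply] using hx)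
    have hli : LinearIndependent (ZMod 2) G.row := by
      refine Matrix.vecMul_injective_iff.1 ((injective_iff_map_eq_zero G.vecMulLinear).2 ?_)
      intro c hc
      by_contra hne
      have h := hdist (dotProductEquiv (ZMod 2) (Fin s) c) (by simpa using hne)
      have hcx : dotProductEquiv (ZMod 2) (Fin s) c ∘ x = 0 := hc
      rw [hcx, hammingNorm_zero] at h
      omega
    exact ⟨_, by rw [finrank_span_eq_card hli, Fintype.card_fin], G, ⟨hli, rfl⟩, hx⟩

theorem isUpperSet_pirLengths {s k : ℕ} (hk : 0 < k) : IsUpperSet (pirLengths s k) := by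
  intro n N hnN hn
  obtain ⟨x, hx⟩ := (mem_pirLengths_iff hk).1 hn
  exact (mem_pirLengths_iff hk).2 ⟨_, fun i => (hx i).extend (Fin.castLEEmb hnN)⟩

theorem eighteen_le_of_mem_pirLengths {n : ℕ} (hn : n ∈ pirLengths 5 8) : 18 ≤ n := by
  by_contra! hlt
  have h17 : 17 ∈ pirLengths 5 8 :=
    isUpperSet_pirLengths (by norm_num) (Nat.le_of_lt_succ hlt) hn
  obtain ⟨x, hx⟩ := (mem_pirLengths_iff (by norm_num)).1 h17
  exact not_forall_isRecoverable_single (Fintype.card_fin 17) x hx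

/-- A generator matrix of a `5`-dimensional `8`-PIR code of length `18`. -/
def generator : Matrix (Fin 5) (Fin 18) (ZMod 2) :=
  !![0, 1, 0, 1, 0, 0, 1, 0, 1, 0, 0, 1, 0, 1, 0, 1, 0, 1;
     1, 1, 0, 1, 0, 1, 1, 0, 0, 1, 0, 0, 1, 1, 0, 0, 1, 1;
     0, 0, 1, 1, 0, 0, 0, 1, 1, 1, 0, 0, 0, 0, 1, 1, 0, 1;
     0, 0, 0, 0, 1, 1, 1, 1, 1, 1, 0, 0, 0, 0, 0, 0, 1, 1;
     0, 0, 0, 0, 0, 0, 0, 0, 0, 0, 1, 1, 1, 1, 1, 1, 1, 1]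

/-- Eight disjoint recovery sets with respect to `generator` for each information bit. -/
def recoverySets : Fin 5 → Fin 8 → Finset (Fin 18) :=
  ![![{0, 1}, {5, 6}, {7, 8}, {10, 11}, {12, 13}, {14, 15}, {2, 16, 17}, {3, 4, 9}],
    ![{0}, {4, 5}, {7, 9}, {10, 12}, {11, 13}, {1, 14, 15}, {2, 6, 8}, {3, 16, 17}],
    ![{2}, {1, 3}, {4, 7}, {5, 9}, {10, 14}, {11, 15}, {0, 6, 8}, {12, 13, 16, 17}],
    ![{4}, {0, 5}, {1, 6}, {2, 7}, {12, 16}, {3, 10, 17}, {8, 11, 14}, {9, 13, 15}],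
    ![{10}, {0, 12}, {1, 13}, {2, 14}, {5, 16}, {3, 4, 17}, {6, 9, 15}, {7, 8, 11}]]

theorem isRecoverable_generator (i : Fin 5) :
    IsRecoverable generator.col 8 (Pi.single i 1 : Fin 5 → ZMod 2) :=
  ⟨recoverySets i, by revert i; unfold Pairwise; decide, by revert i; decide⟩

theorem eighteen_mem_pirLengths : 18 ∈ pirLengths 5 8 :=
  (mem_pirLengths_iff (by norm_num)).2 ⟨generator.col, isRecoverable_generator⟩

end PIR

theorem mainTheorem1 : pirLength 5 8 = 18 :=
  IsLeast.csInf_eq ⟨PIR.eighteen_mem_pirLengths, fun _ => PIR.eighteen_le_of_mem_pirLengths⟩
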